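/- Let $G=(V,E)$ be a finite directed graph, with $V\neq\emptyset$ and $E\subset V\times V$ (loops allowed), that is strongly connected, and such that every vertex has at least one exiting edge. An edge $e=(x,y)$ has tail $\underline e=x$ and head $\overline e=y$. Let $$\Delta_G=\Big\{(p_e)_{e\in E}\in(0,1]^E \ \Big|\ \text{for all } x\in V,\ \sum_{e\in E,\,\underline e=x}p_e=1\Big\}$$ be the set of environments on $G$. For positive weights $\alpha=(\alpha_e)_{e\in E}$, let $\alpha_x=\sum_{\underline e=x}\alpha_e$, and let $\mathbb P^{(\alpha)}$ be the law of a random environment $p=(p_e)_{e\in E}$ whose transition probabilities $(p_e)_{\underline e=x}$, $x\in V$, are independent Dirichlet random variables with parameters $(\alpha_e)_{\underline e=x}$, i.e. $$d\mathbb P^{(\alpha)}(p)=\frac{\prod_{x\in V}\Gamma(\alpha_x)}{\prod_{e\in E}\Gamma(\alpha_e)}\prod_{e\in E}p_e^{\alpha_e-1}\prod_{e\in\widetilde E}dp_e\qquad\text{on }\Delta_G,$$ where $\widetilde E$ is obtained from $E$ by removing, for each vertex $x$, one arbitrarily chosen edge with tail $x$. Let $\check G=(V,\check E)$ be the graph whose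 edges are the reversed edges $\check e=(y,x)$ of the edges $e=(x,y)$ of $G$, and let $\check\alpha_{\check e}=\alpha_e$. Suppose that $\alpha$ has null divergence: for every $x\in V$, $$\mathrm{div}(\alpha)(x)=\alpha_x-\check\alpha_x=\sum_{e\in E,\,\underline e=x}\alpha_e-\sum_{e\in E,\,\overline e=x}\alpha_e=0 .$$ Then $\mathbb P^{(\alpha)}$ is a probability measure concentrated on $\Delta_G$; for every $p\in\Delta_G$ the Markov chain on $V$ with transition probabilities $p$ has a unique invariant probability $(\pi_x)_{x\in V}$; and, under $\mathbb P^{(\alpha)}$, the time-reversed environment $\check p=(\check p_{\check e})_{\check e\in\check E}$ defined by $$\check p_{\check e}=\frac{\pi_{\underline e}}{\pi_{\overline e}}\,p_e\qquad(e\in E)$$ is a Dirichlet environment on $\check G$ with parameters $\check\alpha$, i.e. the law of $\check p$ under $\mathbb P^{(\alpha)}$ is the law $\mathbb P^{(\check\alpha)}$ on environments of $\check G$. (Neither law depends on the choice of removed edges.) -/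

import Mathlib

open MeasureTheory ProbabilityTheory

open scoped Classical in
/-- The vector indexed by `ι` whose coordinates other than `i₀` are given by `q`, and whose
coordinate `i₀` is such that the sum of all coordinates equals `1`. -/
noncomputable def simplexCompletion {ι : Type*} [Fintype ι] (i₀ : ι) (q : {i : ι // i ≠ i₀} → ℝ) :
    ι → ℝ :=
  fun i => if h : i = i₀ then 1 - ∑ j, q j else q ⟨i, h⟩

open scoped Classical in
/-- The Dirichlet density with parameter `a`, at a point `p` of the hyperplane `∑ i, p i = 1`:
`Γ(∑ i, a i) / ∏ i, Γ(a i) * ∏ i, (p i) ^ (a i - 1)` if all coordinates of `p` are positive, and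
`0` otherwise. -/
noncomputable def dirichletDensity {ι : Type*} [Fintype ι] (a : ι → ℝ) (p : ι → ℝ) : ℝ :=
  if ∀ i, 0 < p i then
    Real.Gamma (∑ i, a i) / (∏ i, Real.Gamma (a i)) * ∏ i, p i ^ (a i - 1)
  else 0

open scoped Classical in
/-- The Dirichlet distribution with parameter `a` on the simplex of `ι → ℝ`, defined through its
density with respect to the Lebesgue measure in the coordinates other than `i₀`. If `i₀` is the
only index, this is the Dirac mass at the vector `1`. -/
noncomputable def dirichletMeasure {ι : Type*} [Fintype ι] (i₀ : ι) (a : ι → ℝ) :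
    Measure (ι → ℝ) :=
  ((volume : Measure ({i : ι // i ≠ i₀} → ℝ)).withDensity
    (fun q => ENNReal.ofReal (dirichletDensity a (simplexCompletion i₀ q)))).map
      (simplexCompletion i₀)

namespace Digraph

variable {V : Type*}

/-- The oriented edges of a directed graph; the edge `e` goes from its tail `e.1.1` to its
head `e.1.2`. -/
abbrev Edge (G : Digraph V) : Type _ := {e : V × V // G.Adj e.1 e.2}

/-- The edges exiting from the vertex `x`. -/
abbrev OutEdge (G : Digraph V) (x : V) : Type _ := {e : G.Edge // e.1.1 = x}

/-- The edges entering the vertex `x`. -/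
abbrev InEdge (G : Digraph V) (x : V) : Type _ := {e : G.Edge // e.1.2 = x}

noncomputable instance instFintypeEdge [Fintype V] (G : Digraph V) : Fintype G.Edge :=
  Fintype.ofFinite _

noncomputable instance instFintypeOutEdge [Fintype V] (G : Digraph V) (x : V) :
    Fintype (G.OutEdge x) :=
  Fintype.ofFinite _

noncomputable instance instFintypeInEdge [Fintype V] (G : Digraph V) (x : V) :
    Fintype (G.InEdge x) :=
  Fintype.ofFinite _

/-- There is a directed path from any vertex to any vertex. -/
def StronglyConnected (G : Digraph V) : Prop :=
  ∀ x y : V, Relation.ReflTransGen G.Adj x y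

/-- The graph obtained by reversing all the edges. -/
def reversal (G : Digraph V) : Digraph V where
  Adj x y := G.Adj y x

/-- The edge of `G` whose reversal is the given edge of the reversed graph. -/
def unreverse (G : Digraph V) (e : G.reversal.Edge) : G.Edge :=
  ⟨(e.1.2, e.1.1), e.2⟩

/-- The reversed weights: the reversal of the edge `e` receives the weight of `e`. -/
def reversedWeight (G : Digraph V) (α : G.Edge → ℝ) : G.reversal.Edge → ℝ :=
  fun e => α (G.unreverse e)

variable [Fintype V]

/-- The sum of the weights of the edges exiting from `x`. -/
noncomputable def outWeight (G : Digraph V) (α : G.Edge → ℝ) (x : V) : ℝ :=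
  ∑ e : G.OutEdge x, α e.1

/-- The divergence of the weights. -/
noncomputable def divergence (G : Digraph V) (α : G.Edge → ℝ) (x : V) : ℝ :=
  G.outWeight α x - G.reversal.outWeight (G.reversedWeight α) x

/-- The set of environments on `G`: positive transition probabilities on the edges. -/
def environments (G : Digraph V) : Set (G.Edge → ℝ) :=
  {p | (∀ e, 0 < p e) ∧ ∀ x, ∑ e : G.OutEdge x, p e.1 = 1}

/-- `π` is an invariant probability of the Markov chain with transition probabilities `p`. -/
def IsInvariantProb (G : Digraph V) (p : G.Edge → ℝ) (π : V → ℝ) : Prop :=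
  (∀ x, 0 ≤ π x) ∧ ∑ x, π x = 1 ∧ ∀ y, ∑ e : G.InEdge y, π e.1.1.1 * p e.1 = π y

open scoped Classical in
/-- The invariant probability of the Markov chain with transition probabilities `p`
(`0` where there is none; it is unique when `G` is strongly connected and `p` an environment). -/
noncomputable def invariantProb (G : Digraph V) (p : G.Edge → ℝ) : V → ℝ :=
  if h : ∃ π, G.IsInvariantProb p π then h.choose else 0

/-- The environment on the reversed graph obtained from `p` by time reversal: the reversal of an
edge `e` from `x` to `y` receives the value `π x / π y * p e`. -/
noncomputable def reversedEnvironment (G : Digraph V) (p : G.Edge → ℝ) : G.reversal.Edge → ℝ :=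
  fun e => G.invariantProb p (G.unreverse e).1.1 / G.invariantProb p (G.unreverse e).1.2 *
    p (G.unreverse e)

/-- The law of the Dirichlet environment with parameters `α`: the transition probabilities at the
vertices `x` are independent Dirichlet random variables with parameters the weights of the edges
exiting from `x`. The density at `x` is written in the coordinates other than `r x`. -/
noncomputable def dirichletLaw (G : Digraph V) (r : ∀ x, G.OutEdge x) (α : G.Edge → ℝ) :
    Measure (G.Edge → ℝ) :=
  (Measure.pi fun x : V => dirichletMeasure (r x) fun e : G.OutEdge x => α e.1).map
    fun (q : ∀ x, G.OutEdge x → ℝ) (e : G.Edge) => q e.1.1 ⟨e, rfl⟩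

end Digraph

/-!
The time reversal is handled through moments, without any change of variables. Write `π` for the
invariant probability of an environment `p`, and call a nonnegative real vector `n` on the edges
a flow if its divergence vanishes.

* Along a flow the factors `π x / π y` cancel, so `∏ e, p e ^ n e` equals the same monomial of the
  reversed environment for the reversed flow (`Digraph.prod_reversedEnvironment_rpow`).
* The moments of a Dirichlet environment are products of values of `Γ` at the edge weights and at
  the vertex sums (`Digraph.integral_prod_rpow_dirichletLaw`). If both `α` and `n` are free of
  divergence, these vertex sums are the same for the reversed graph, so the moments agree
  (`Digraph.integral_prod_rpow_reversal`). The moments themselves come from the Dirichlet integral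
  `lintegral_dirichletKernel`.
* Flow monomials are bounded, closed under multiplication, and separate environments: with the
  stationary flow `n e = π x * p e`, equality of `∏ e, p e ^ n e` and `∏ e, q e ^ n e` says that
  an average of relative entropies of `p` with respect to `q` vanishes
  (`Digraph.eq_of_prod_rpow_eq`). A law on environments is therefore determined by its flow
  moments (`Digraph.measure_ext_of_integral_prod_rpow`), and this applies to the law of the
  reversed environment and to the Dirichlet law on the reversed graph.

Allowing real exponents, and not only integers, is what makes the stationary flow available; no
cycle decomposition is needed. A nonzero invariant signed vector exists because `1` is an eigenvalue
of the transition matrix. Its absolute value is again invariant (`Digraph.IsInvariant.abs`), which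
gives existence, uniqueness and positivity of `π`. Measurability of `π` in `p` comes from an
explicit linear system with an invertible matrix (`Digraph.invariantProb_eq_vecMul_inv`).
-/

/-! ### The Dirichlet distribution -/

section Dirichlet

lemma measurableSet_forall_pos {ι : Type*} [Finite ι] :
    MeasurableSet {p : ι → ℝ | ∀ i, 0 < p i} := by
  simp only [Set.ofPred_forall]
  exact MeasurableSet.iInter fun i => measurableSet_lt measurable_const (measurable_pi_apply i)

variable {ι : Type*} [Fintype ι]

open scoped Classical in
lemma simplexCompletion_self (i₀ : ι) (q : {i : ι // i ≠ i₀} → ℝ) :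
    simplexCompletion i₀ q i₀ = 1 - ∑ j, q j := by
  simp [simplexCompletion]

lemma simplexCompletion_of_ne (i₀ : ι) (q : {i : ι // i ≠ i₀} → ℝ) (j : {i : ι // i ≠ i₀}) :
    simplexCompletion i₀ q j = q j := by
  simp [simplexCompletion, j.2]

open scoped Classical in
lemma sum_simplexCompletion (i₀ : ι) (q : {i : ι // i ≠ i₀} → ℝ) :
    ∑ i, simplexCompletion i₀ q i = 1 := by
  rw [Fintype.sum_eq_add_sum_subtype_ne _ i₀, simplexCompletion_self]
  simp [simplexCompletion_of_ne]

open scoped Classical in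
lemma measurable_simplexCompletion (i₀ : ι) : Measurable (simplexCompletion i₀) := by
  refine measurable_pi_lambda _ fun i => ?_
  by_cases h : i = i₀
  · subst h
    simp only [simplexCompletion_self]
    fun_prop
  · simp only [simplexCompletion, h, dite_false]
    fun_prop

/-- The monomial `∏ i, p i ^ (a i - 1)` on the open positive orthant, extended by `0`: the
Dirichlet density without its normalizing constant. -/
noncomputable def dirichletKernel (a p : ι → ℝ) : ℝ :=
  open scoped Classical in if ∀ i, 0 < p i then ∏ i, p i ^ (a i - 1) else 0

lemma measurable_dirichletKernel (a : ι → ℝ) : Measurable (dirichletKernel a) := by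
  unfold dirichletKernel
  exact Measurable.ite measurableSet_forall_pos (by fun_prop) measurable_const

lemma measurable_dirichletKernel_simplexCompletion (i₀ : ι) (a : ι → ℝ) :
    Measurable fun q => dirichletKernel a (simplexCompletion i₀ q) :=
  (measurable_dirichletKernel a).comp (measurable_simplexCompletion i₀)

lemma dirichletKernel_nonneg (a p : ι → ℝ) : 0 ≤ dirichletKernel a p := by
  unfold dirichletKernel
  split_ifs with h
  · exact Finset.prod_nonneg fun i _ => (Real.rpow_pos_of_pos (h i) _).le
  · rfl

lemma dirichletDensity_eq (a p : ι → ℝ) : dirichletDensity a p =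
    Real.Gamma (∑ i, a i) / (∏ i, Real.Gamma (a i)) * dirichletKernel a p := by
  unfold dirichletDensity dirichletKernel
  split_ifs <;> simp

/-- The density of Euler's integral for `Γ(a)`, extended by `0` to the whole line. -/
noncomputable def gammaKernel (a x : ℝ) : ℝ :=
  (Set.Ioi 0).indicator (fun x => Real.exp (-x) * x ^ (a - 1)) x

lemma measurable_gammaKernel (a : ℝ) : Measurable (gammaKernel a) :=
  Measurable.indicator (by fun_prop) measurableSet_Ioi

lemma gammaKernel_nonneg (a x : ℝ) : 0 ≤ gammaKernel a x :=
  Set.indicator_nonneg (fun x (hx : 0 < x) => by positivity) x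

lemma gammaKernel_of_pos (a : ℝ) {x : ℝ} (hx : 0 < x) :
    gammaKernel a x = Real.exp (-x) * x ^ (a - 1) :=
  Set.indicator_of_mem (s := Set.Ioi (0 : ℝ)) hx _

lemma gammaKernel_of_nonpos (a : ℝ) {x : ℝ} (hx : x ≤ 0) : gammaKernel a x = 0 :=
  Set.indicator_of_notMem (by simpa using hx) _

lemma integrable_gammaKernel {a : ℝ} (ha : 0 < a) : Integrable (gammaKernel a) :=
  (Real.GammaIntegral_convergent ha).integrable_indicator measurableSet_Ioi

lemma integral_gammaKernel {a : ℝ} (ha : 0 < a) : ∫ x, gammaKernel a x = Real.Gamma a := by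
  rw [Real.Gamma_eq_integral ha, ← integral_indicator measurableSet_Ioi]
  rfl

lemma lintegral_gammaKernel {a : ℝ} (ha : 0 < a) :
    ∫⁻ x, ENNReal.ofReal (gammaKernel a x) = ENNReal.ofReal (Real.Gamma a) := by
  rw [← integral_gammaKernel ha, ofReal_integral_eq_lintegral_ofReal (integrable_gammaKernel ha)
    (ae_of_all _ (gammaKernel_nonneg a))]

lemma lintegral_prod_gammaKernel {a : ι → ℝ} (ha : ∀ i, 0 < a i) :
    ∫⁻ x : ι → ℝ, ENNReal.ofReal (∏ i, gammaKernel (a i) (x i)) =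
      ENNReal.ofReal (∏ i, Real.Gamma (a i)) := by
  rw [← ofReal_integral_eq_lintegral_ofReal]
  · rw [integral_fintype_prod_volume_eq_prod]
    simp_rw [integral_gammaKernel (ha _)]
  · exact Integrable.fintype_prod (fun i => integrable_gammaKernel (ha i))
  · exact ae_of_all _ fun x => Finset.prod_nonneg fun i _ => gammaKernel_nonneg _ _

/-- On the simplex dilated by `s`, the product of the gamma densities splits into a function of
`s` and the Dirichlet kernel, since the exponentials multiply to `exp (-s)`. -/
lemma prod_gammaKernel_mul (a : ι → ℝ) {c : ι → ℝ} (hc : ∑ i, c i = 1) {s : ℝ} (hs : 0 < s) :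
    ∏ i, gammaKernel (a i) (s * c i) =
      Real.exp (-s) * s ^ (∑ i, (a i - 1)) * dirichletKernel a c := by
  unfold dirichletKernel
  split_ifs with h
  · have h1 : ∀ i, gammaKernel (a i) (s * c i) =
        Real.exp (-(s * c i)) * s ^ (a i - 1) * c i ^ (a i - 1) := fun i => by
      rw [gammaKernel_of_pos _ (mul_pos hs (h i)), Real.mul_rpow hs.le (h i).le, mul_assoc]
    simp_rw [h1, Finset.prod_mul_distrib, ← Real.exp_sum, Finset.sum_neg_distrib,
      ← Finset.mul_sum, hc, mul_one, Real.rpow_sum_of_pos hs]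
  · push Not at h
    obtain ⟨i, hi⟩ := h
    rw [mul_zero]
    exact Finset.prod_eq_zero (Finset.mem_univ i)
      (gammaKernel_of_nonpos _ (mul_nonpos_of_nonneg_of_nonpos hs.le hi))

lemma lintegral_comp_pos_smul {κ : Type*} [Fintype κ] {s : ℝ} (hs : 0 < s)
    {F : (κ → ℝ) → ENNReal} (hF : Measurable F) :
    ∫⁻ y, F y = ENNReal.ofReal (s ^ Fintype.card κ) * ∫⁻ q, F (s • q) := by
  have h := Measure.map_addHaar_smul (volume : Measure (κ → ℝ)) hs.ne'
  have h2 : ∫⁻ q, F (s • q) = ∫⁻ y, F y ∂(Measure.map (s • ·) (volume : Measure (κ → ℝ))) :=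
    (lintegral_map hF (measurable_const_smul s)).symm
  rw [h2, h, lintegral_smul_measure, smul_eq_mul, ← mul_assoc, ← ENNReal.ofReal_mul (by positivity),
    abs_of_pos (by positivity), Module.finrank_fintype_fun_eq_card, mul_inv_cancel₀ (by positivity)]
  simp

open scoped Classical in
/-- The Dirichlet integral. It is read off from the product of the integrals for `Γ (a i)` by
substituting the sum `s` of all variables for the variable `i₀`, and then scaling the other
variables by `s`. -/
lemma lintegral_dirichletKernel (i₀ : ι) {a : ι → ℝ} (ha : ∀ i, 0 < a i) :
    ENNReal.ofReal (Real.Gamma (∑ i, a i)) *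
      ∫⁻ q, ENNReal.ofReal (dirichletKernel a (simplexCompletion i₀ q)) =
        ENNReal.ofReal (∏ i, Real.Gamma (a i)) := by
  have hm (b : ℝ) : Measurable (gammaKernel b) := measurable_gammaKernel b
  have hΓ : ∀ i, 0 ≤ Real.Gamma (a i) := fun i => (Real.Gamma_pos_of_pos (ha i)).le
  set F : ℝ → ({i : ι // i ≠ i₀} → ℝ) → ENNReal := fun s y =>
    ENNReal.ofReal (∏ j : {i : ι // i ≠ i₀}, gammaKernel (a j) (y j)) *
      ENNReal.ofReal (gammaKernel (a i₀) (s - ∑ j, y j)) with hF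
  have hFm : Measurable (Function.uncurry F) := by
    simp only [hF, Function.uncurry_def]
    fun_prop
  have hFs (s : ℝ) : Measurable (F s) := by
    simp only [hF]
    fun_prop
  have h1 : ∫⁻ y, ∫⁻ s, F s y = ENNReal.ofReal (∏ i, Real.Gamma (a i)) := by
    have : ∀ y, ∫⁻ s, F s y =
        ENNReal.ofReal (∏ j : {i : ι // i ≠ i₀}, gammaKernel (a j) (y j)) *
          ENNReal.ofReal (Real.Gamma (a i₀)) := fun y => by
      simp only [hF]
      rw [lintegral_const_mul _ (by fun_prop),
        lintegral_sub_right_eq_self (fun s => ENNReal.ofReal (gammaKernel (a i₀) s)),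
        lintegral_gammaKernel (ha i₀)]
    simp_rw [this]
    rw [lintegral_mul_const _ (by fun_prop),
      lintegral_prod_gammaKernel (a := fun j : {i : ι // i ≠ i₀} => a j) (fun j => ha j),
      ← ENNReal.ofReal_mul (Finset.prod_nonneg fun j _ => hΓ j.1),
      Fintype.prod_eq_mul_prod_subtype_ne _ i₀, mul_comm]
  have h2 : ∀ s, ∫⁻ y, F s y = ENNReal.ofReal (gammaKernel (∑ i, a i) s) *
      ∫⁻ q, ENNReal.ofReal (dirichletKernel a (simplexCompletion i₀ q)) := fun s => by
    rcases le_or_gt s 0 with hs | hs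
    · rw [gammaKernel_of_nonpos _ hs, ENNReal.ofReal_zero, zero_mul]
      refine lintegral_eq_zero_of_ae_eq_zero (ae_of_all _ fun y => ?_)
      simp only [hF, Pi.zero_apply, mul_eq_zero]
      by_cases hy : ∀ j, 0 < y j
      · right
        rw [gammaKernel_of_nonpos, ENNReal.ofReal_zero]
        have := Finset.sum_nonneg fun j (_ : j ∈ Finset.univ) => (hy j).le
        linarith
      · left
        push Not at hy
        obtain ⟨j, hj⟩ := hy
        rw [Finset.prod_eq_zero (Finset.mem_univ j) (gammaKernel_of_nonpos _ hj),
          ENNReal.ofReal_zero]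
    · rw [lintegral_comp_pos_smul hs (hFs s)]
      have h3 : ∀ q, F s (s • q) = ENNReal.ofReal (Real.exp (-s) * s ^ (∑ i, (a i - 1))) *
          ENNReal.ofReal (dirichletKernel a (simplexCompletion i₀ q)) := fun q => by
        rw [← ENNReal.ofReal_mul (by positivity),
          ← prod_gammaKernel_mul a (sum_simplexCompletion i₀ q) hs,
          Fintype.prod_eq_mul_prod_subtype_ne _ i₀, mul_comm,
          ENNReal.ofReal_mul (Finset.prod_nonneg fun i _ => gammaKernel_nonneg _ _)]
        simp only [hF, simplexCompletion_self, simplexCompletion_of_ne, Pi.smul_apply,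
          smul_eq_mul, ← Finset.mul_sum]
        ring_nf
      simp_rw [h3]
      rw [lintegral_const_mul _
        (measurable_dirichletKernel_simplexCompletion i₀ a).ennreal_ofReal, ← mul_assoc,
        ← ENNReal.ofReal_mul (by positivity), gammaKernel_of_pos _ hs]
      congr 2
      rw [mul_left_comm, ← Real.rpow_natCast, ← Real.rpow_add hs]
      congr 2
      have : 1 ≤ Fintype.card ι := Fintype.card_pos_iff.2 ⟨i₀⟩
      simp [Fintype.card_subtype_compl, Nat.cast_sub this]
  rw [← h1, lintegral_lintegral_swap (f := fun y s => F s y)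
    (hFm.comp measurable_swap).aemeasurable]
  simp_rw [h2]
  rw [lintegral_mul_const _ (by fun_prop), lintegral_gammaKernel]
  exact Finset.sum_pos (fun i _ => ha i) ⟨i₀, Finset.mem_univ _⟩

open scoped Classical in
lemma integral_dirichletKernel (i₀ : ι) {a : ι → ℝ} (ha : ∀ i, 0 < a i) :
    ∫ q, dirichletKernel a (simplexCompletion i₀ q) =
      (∏ i, Real.Gamma (a i)) / Real.Gamma (∑ i, a i) := by
  have hpos : 0 < Real.Gamma (∑ i, a i) :=
    Real.Gamma_pos_of_pos (Finset.sum_pos (fun i _ => ha i) ⟨i₀, Finset.mem_univ _⟩)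
  have h := congrArg ENNReal.toReal (lintegral_dirichletKernel i₀ ha)
  rw [ENNReal.toReal_mul, ENNReal.toReal_ofReal hpos.le, ENNReal.toReal_ofReal
    (Finset.prod_nonneg fun i _ => (Real.Gamma_pos_of_pos (ha i)).le)] at h
  rw [integral_eq_lintegral_of_nonneg_ae (ae_of_all _ fun q => dirichletKernel_nonneg _ _)
    (measurable_dirichletKernel_simplexCompletion i₀ a).aestronglyMeasurable,
    eq_div_iff hpos.ne', ← h, mul_comm]

lemma measurable_dirichletDensity (a : ι → ℝ) : Measurable (dirichletDensity a) := by
  simp_rw [funext (dirichletDensity_eq a)]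
  exact (measurable_dirichletKernel a).const_mul _

lemma measurable_dirichletDensity_simplexCompletion (i₀ : ι) (a : ι → ℝ) :
    Measurable fun q => dirichletDensity a (simplexCompletion i₀ q) :=
  (measurable_dirichletDensity a).comp (measurable_simplexCompletion i₀)

lemma dirichletDensity_nonneg {a : ι → ℝ} (ha : ∀ i, 0 < a i) (p : ι → ℝ) :
    0 ≤ dirichletDensity a p := by
  rw [dirichletDensity_eq]
  refine mul_nonneg (div_nonneg (Real.Gamma_nonneg_of_nonneg ?_) ?_) (dirichletKernel_nonneg a p)
  · exact Finset.sum_nonneg fun i _ => (ha i).le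
  · exact Finset.prod_nonneg fun i _ => Real.Gamma_nonneg_of_nonneg (ha i).le

open scoped Classical in
lemma isProbabilityMeasure_dirichletMeasure (i₀ : ι) {a : ι → ℝ} (ha : ∀ i, 0 < a i) :
    IsProbabilityMeasure (dirichletMeasure i₀ a) := by
  have hpos : 0 < Real.Gamma (∑ i, a i) :=
    Real.Gamma_pos_of_pos (Finset.sum_pos (fun i _ => ha i) ⟨i₀, Finset.mem_univ _⟩)
  have hprod : 0 < ∏ i, Real.Gamma (a i) :=
    Finset.prod_pos fun i _ => Real.Gamma_pos_of_pos (ha i)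
  constructor
  rw [dirichletMeasure, Measure.map_apply (measurable_simplexCompletion i₀) MeasurableSet.univ,
    Set.preimage_univ, withDensity_apply _ MeasurableSet.univ, Measure.restrict_univ]
  simp_rw [dirichletDensity_eq, ENNReal.ofReal_mul (div_nonneg hpos.le hprod.le)]
  rw [lintegral_const_mul _ (measurable_dirichletKernel_simplexCompletion i₀ a).ennreal_ofReal,
    ENNReal.ofReal_div_of_pos hprod,
    ENNReal.mul_comm_div, ← mul_div_assoc, lintegral_dirichletKernel i₀ ha, ENNReal.div_self]
  · simpa using hprod
  · exact ENNReal.ofReal_ne_top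

open scoped Classical in
lemma ae_dirichletMeasure (i₀ : ι) (a : ι → ℝ) :
    ∀ᵐ p ∂(dirichletMeasure i₀ a), (∀ i, 0 < p i) ∧ ∑ i, p i = 1 := by
  have hS : MeasurableSet {p : ι → ℝ | (∀ i, 0 < p i) ∧ ∑ i, p i = 1} := by
    refine MeasurableSet.inter measurableSet_forall_pos
      (measurableSet_eq_fun (by fun_prop) measurable_const)
  rw [dirichletMeasure, ae_map_iff (measurable_simplexCompletion i₀).aemeasurable hS,
    ae_withDensity_iff (measurable_dirichletDensity_simplexCompletion i₀ a).ennreal_ofReal]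
  refine ae_of_all _ fun q hq => ⟨?_, sum_simplexCompletion i₀ q⟩
  by_contra h
  exact hq (by rw [dirichletDensity, if_neg h, ENNReal.ofReal_zero])

open scoped Classical in
/-- The moments of a Dirichlet distribution, for real exponents: multiplying the density by a
monomial gives the density of another Dirichlet distribution, up to the normalizing constants. -/
lemma integral_prod_rpow_dirichletMeasure (i₀ : ι) {a n : ι → ℝ} (ha : ∀ i, 0 < a i)
    (hn : ∀ i, 0 ≤ n i) :
    ∫ p, ∏ i, p i ^ n i ∂(dirichletMeasure i₀ a) =
      Real.Gamma (∑ i, a i) / Real.Gamma (∑ i, (a i + n i)) *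
        ∏ i, (Real.Gamma (a i + n i) / Real.Gamma (a i)) := by
  have hm : Measurable fun p : ι → ℝ => ∏ i, p i ^ n i := by fun_prop
  have hd := measurable_dirichletDensity_simplexCompletion i₀ a
  have h : ∀ p : ι → ℝ, dirichletDensity a p * ∏ i, p i ^ n i =
      Real.Gamma (∑ i, a i) / (∏ i, Real.Gamma (a i)) *
        dirichletKernel (fun i => a i + n i) p := fun p => by
    rw [dirichletDensity_eq, mul_assoc]
    congr 1
    unfold dirichletKernel
    split_ifs with hp
    · rw [← Finset.prod_mul_distrib]
      refine Finset.prod_congr rfl fun i _ => ?_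
      rw [← Real.rpow_add (hp i)]
      ring_nf
    · exact zero_mul _
  rw [dirichletMeasure, integral_map (measurable_simplexCompletion i₀).aemeasurable
    hm.aestronglyMeasurable, integral_withDensity_eq_integral_toReal_smul hd.ennreal_ofReal
      (ae_of_all _ fun _ => ENNReal.ofReal_lt_top)]
  simp_rw [ENNReal.toReal_ofReal (dirichletDensity_nonneg ha _), smul_eq_mul, h]
  rw [integral_const_mul, integral_dirichletKernel i₀
    fun i => add_pos_of_pos_of_nonneg (ha i) (hn i),
    Finset.prod_div_distrib]
  ring

end Dirichlet

namespace Digraph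

variable {V : Type*} {G : Digraph V}

/-! ### Sums over the edges, and reversal -/

@[to_additive]
lemma prod_outEdge [Fintype V] {M : Type*} [CommMonoid M] (f : G.Edge → M) :
    ∏ x, ∏ e : G.OutEdge x, f e.1 = ∏ e, f e := by
  classical
  rw [← Fintype.prod_fiberwise (fun e : G.Edge => e.1.1) f]
  congr!

@[to_additive]
lemma prod_inEdge [Fintype V] {M : Type*} [CommMonoid M] (f : G.Edge → M) :
    ∏ x, ∏ e : G.InEdge x, f e.1 = ∏ e, f e := by
  classical
  rw [← Fintype.prod_fiberwise (fun e : G.Edge => e.1.2) f]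
  congr!

lemma StronglyConnected.reversal (hG : G.StronglyConnected) : G.reversal.StronglyConnected :=
  fun x y => (hG y x).swap

/-- The bijection between the edges of the reversed graph and those of the graph. -/
def unreverseEquiv (G : Digraph V) : G.reversal.Edge ≃ G.Edge where
  toFun := G.unreverse
  invFun e := ⟨(e.1.2, e.1.1), e.2⟩
  left_inv _ := rfl
  right_inv _ := rfl

/-- Under reversal, the edges exiting from `x` become the edges entering `x`. -/
def outEdgeReversalEquiv (G : Digraph V) (x : V) : G.reversal.OutEdge x ≃ G.InEdge x :=
  G.unreverseEquiv.subtypeEquiv fun _ => Iff.rfl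

lemma sum_outEdge_reversal [Fintype V] (f : G.Edge → ℝ) (x : V) :
    ∑ e : G.reversal.OutEdge x, f (G.unreverse e.1) = ∑ e : G.InEdge x, f e.1 :=
  (G.outEdgeReversalEquiv x).sum_comp fun e => f e.1

/-! ### Invariant vectors of an environment -/

variable [Fintype V]

/-- A signed vector that is invariant under the transition probabilities `p`. -/
def IsInvariant (G : Digraph V) (p : G.Edge → ℝ) (v : V → ℝ) : Prop :=
  ∀ y, ∑ e : G.InEdge y, v e.1.1.1 * p e.1 = v y

variable {p : G.Edge → ℝ} {v : V → ℝ}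

lemma sum_inEdge_mul (hp : p ∈ G.environments) (v : V → ℝ) :
    ∑ y, ∑ e : G.InEdge y, v e.1.1.1 * p e.1 = ∑ x, v x := by
  rw [sum_inEdge fun e => v e.1.1 * p e, ← sum_outEdge]
  refine Finset.sum_congr rfl fun x _ => ?_
  rw [← mul_one (v x), ← hp.2 x, Finset.mul_sum]
  exact Finset.sum_congr rfl fun e _ => by rw [e.2]

lemma IsInvariant.add {w : V → ℝ} (hv : G.IsInvariant p v) (hw : G.IsInvariant p w) :
    G.IsInvariant p (fun x => v x + w x) := fun y => by
  simp only [add_mul, Finset.sum_add_distrib, hv y, hw y]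

lemma IsInvariant.const_mul (c : ℝ) (hv : G.IsInvariant p v) :
    G.IsInvariant p (fun x => c * v x) := fun y => by
  simp only [mul_assoc, ← Finset.mul_sum, hv y]

/-- The absolute value of an invariant vector is subinvariant by the triangle inequality, hence
invariant since the total mass is preserved. -/
lemma IsInvariant.abs (hp : p ∈ G.environments) (hv : G.IsInvariant p v) :
    G.IsInvariant p (fun x => |v x|) := by
  have h : ∀ y ∈ Finset.univ, |v y| ≤ ∑ e : G.InEdge y, |v e.1.1.1| * p e.1 := fun y _ => by
    rw [← hv y]
    refine (Finset.abs_sum_le_sum_abs _ _).trans_eq (Finset.sum_congr rfl fun e _ => ?_)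
    rw [abs_mul, abs_of_pos (hp.1 e.1)]
  exact fun y => ((Finset.sum_eq_sum_iff_of_le h).1 (sum_inEdge_mul hp fun x => |v x|).symm y
    (Finset.mem_univ y)).symm

lemma IsInvariant.pos (hG : G.StronglyConnected) (hp : p ∈ G.environments)
    (hv : G.IsInvariant p v) (h0 : ∀ x, 0 ≤ v x) {x : V} (hx : v x ≠ 0) (y : V) : 0 < v y := by
  induction hG x y with
  | refl => exact (h0 x).lt_of_ne' hx
  | @tail y z _ hyz ih =>
    rw [← hv z]
    exact Finset.sum_pos' (fun e _ => mul_nonneg (h0 _) (hp.1 _).le)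
      ⟨⟨⟨(y, z), hyz⟩, rfl⟩, Finset.mem_univ _, mul_pos ih (hp.1 _)⟩

/-- An invariant vector of total mass zero vanishes: otherwise `|v|` is positive everywhere, and
`|v| + v` either vanishes or is positive everywhere, so that `v` has a constant strict sign. -/
lemma IsInvariant.eq_zero (hG : G.StronglyConnected) (hp : p ∈ G.environments)
    (hv : G.IsInvariant p v) (hsum : ∑ x, v x = 0) : v = 0 := by
  by_contra hne
  obtain ⟨x, hx⟩ := Function.ne_iff.1 hne
  have habs := (hv.abs hp).pos hG hp (fun x => abs_nonneg _) (x := x) (by simpa using hx)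
  by_cases hw : ∃ z, |v z| + v z ≠ 0
  · obtain ⟨z, hz⟩ := hw
    have hpos := ((hv.abs hp).add hv).pos hG hp
      (fun x => by linarith [neg_abs_le (v x)]) (x := z) hz
    refine (Finset.sum_pos (fun y _ => ?_) ⟨x, Finset.mem_univ x⟩).ne' hsum
    by_contra hy
    have := hpos y
    rw [abs_of_nonpos (not_lt.1 hy)] at this
    linarith
  · push Not at hw
    refine (Finset.sum_neg (fun y _ => ?_) ⟨x, Finset.mem_univ x⟩).ne hsum
    linarith [habs y, hw y]

open scoped Classical in
/-- The transition matrix of an environment. -/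
noncomputable def transitionMatrix (G : Digraph V) (p : G.Edge → ℝ) : Matrix V V ℝ :=
  Matrix.of fun x y => ∑ e : G.InEdge y, if e.1.1.1 = x then p e.1 else 0

open Matrix in
lemma vecMul_transitionMatrix (p : G.Edge → ℝ) (v : V → ℝ) (y : V) :
    (v ᵥ* G.transitionMatrix p) y = ∑ e : G.InEdge y, v e.1.1.1 * p e.1 := by
  classical
  simp only [Matrix.vecMul, dotProduct, transitionMatrix, Matrix.of_apply, Finset.mul_sum]
  rw [Finset.sum_comm]
  simp

open Matrix in
lemma transitionMatrix_mulVec_one (hp : p ∈ G.environments) :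
    G.transitionMatrix p *ᵥ 1 = 1 := by
  classical
  ext x
  simp only [Matrix.mulVec, dotProduct, transitionMatrix, Matrix.of_apply, Pi.one_apply, mul_one]
  rw [sum_inEdge fun e => if e.1.1 = x then p e else 0, ← sum_outEdge, Finset.sum_eq_single x,
    ← hp.2 x]
  · exact Finset.sum_congr rfl fun e _ => by rw [if_pos e.2]
  · intro y _ hy
    exact Finset.sum_eq_zero fun e _ => by rw [if_neg (by rw [e.2]; exact hy)]
  · simp

lemma exists_isInvariant_ne_zero [Nonempty V] (hp : p ∈ G.environments) :
    ∃ v ≠ 0, G.IsInvariant p v := by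
  classical
  have hdet : (1 - G.transitionMatrix p).det = 0 :=
    Matrix.exists_mulVec_eq_zero_iff.1 ⟨1, one_ne_zero, by
      rw [Matrix.sub_mulVec, transitionMatrix_mulVec_one hp, Matrix.one_mulVec, sub_self]⟩
  obtain ⟨v, hv, h⟩ := Matrix.exists_vecMul_eq_zero_iff.2 hdet
  refine ⟨v, hv, fun y => ?_⟩
  rw [Matrix.vecMul_sub, Matrix.vecMul_one, sub_eq_zero] at h
  rw [← vecMul_transitionMatrix, ← h]

lemma existsUnique_isInvariantProb [Nonempty V] (hG : G.StronglyConnected)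
    (hp : p ∈ G.environments) : ∃! π : V → ℝ, G.IsInvariantProb p π := by
  obtain ⟨v, hv0, hv⟩ := exists_isInvariant_ne_zero hp
  obtain ⟨x, hx⟩ := Function.ne_iff.1 hv0
  have hpos := (hv.abs hp).pos hG hp (fun x => abs_nonneg _) (x := x) (by simpa using hx)
  have hsum : 0 < ∑ x, |v x| := Finset.sum_pos (fun x _ => hpos x) ⟨x, Finset.mem_univ x⟩
  refine ⟨fun x => (∑ x, |v x|)⁻¹ * |v x|, ⟨fun x => by positivity, ?_,
    (hv.abs hp).const_mul _⟩, fun π hπ => ?_⟩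
  · rw [← Finset.mul_sum, inv_mul_cancel₀ hsum.ne']
  · have hd : G.IsInvariant p fun y => π y + -1 * ((∑ x, |v x|)⁻¹ * |v y|) :=
      IsInvariant.add hπ.2.2 (((hv.abs hp).const_mul _).const_mul _)
    have h0 := hd.eq_zero hG hp (by
      rw [Finset.sum_add_distrib, hπ.2.1, ← Finset.mul_sum, ← Finset.mul_sum,
        inv_mul_cancel₀ hsum.ne']
      norm_num)
    ext y
    have := congrFun h0 y
    simp only [Pi.zero_apply] at this
    linarith

lemma isInvariantProb_invariantProb [Nonempty V] (hG : G.StronglyConnected)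
    (hp : p ∈ G.environments) : G.IsInvariantProb p (G.invariantProb p) := by
  have h := (existsUnique_isInvariantProb hG hp).exists
  rw [invariantProb, dif_pos h]
  exact h.choose_spec

lemma invariantProb_pos [Nonempty V] (hG : G.StronglyConnected) (hp : p ∈ G.environments)
    (x : V) : 0 < G.invariantProb p x := by
  have h := isInvariantProb_invariantProb hG hp
  obtain ⟨y, -, hy⟩ := Finset.exists_ne_zero_of_sum_ne_zero (h.2.1.trans_ne one_ne_zero)
  exact IsInvariant.pos hG hp h.2.2 h.1 hy x

lemma reversedEnvironment_mem_environments [Nonempty V] (hG : G.StronglyConnected)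
    (hp : p ∈ G.environments) : G.reversedEnvironment p ∈ G.reversal.environments := by
  have hπ := invariantProb_pos hG hp
  refine ⟨fun e => mul_pos (div_pos (hπ _) (hπ _)) (hp.1 _), fun x => ?_⟩
  unfold reversedEnvironment
  rw [sum_outEdge_reversal fun e => G.invariantProb p e.1.1 / G.invariantProb p e.1.2 * p e,
    ← div_self (hπ x).ne']
  refine Eq.trans ?_ (congrArg (· / _) ((isInvariantProb_invariantProb hG hp).2.2 x))
  rw [Finset.sum_div]
  exact Finset.sum_congr rfl fun e _ => by rw [e.2, div_mul_eq_mul_div]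

/-! ### Measurability of the reversed environment -/

open Matrix in
/-- The invariant probability solves a linear system with an invertible matrix. -/
lemma invariantProb_eq_vecMul_inv [Nonempty V] [DecidableEq V] (hG : G.StronglyConnected)
    (hp : p ∈ G.environments) :
    G.invariantProb p =
      (1 : V → ℝ) ᵥ* (1 - G.transitionMatrix p + Matrix.of fun _ _ => (1 : ℝ))⁻¹ := by
  have hJ : ∀ (u : V → ℝ) (y : V), (u ᵥ* Matrix.of fun _ _ => (1 : ℝ)) y = ∑ x, u x :=
    fun u y => by simp [Matrix.vecMul, dotProduct]
  have hM : ∀ (u : V → ℝ) (y : V),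
      (u ᵥ* (1 - G.transitionMatrix p + Matrix.of fun _ _ => (1 : ℝ))) y =
        u y - ∑ e : G.InEdge y, u e.1.1.1 * p e.1 + ∑ x, u x := fun u y => by
    rw [Matrix.vecMul_add, Matrix.vecMul_sub, Matrix.vecMul_one, Pi.add_apply, hJ, Pi.sub_apply,
      vecMul_transitionMatrix]
  have hdet : (1 - G.transitionMatrix p + Matrix.of fun _ _ => (1 : ℝ)).det ≠ 0 := by
    rw [Ne, ← Matrix.exists_vecMul_eq_zero_iff]
    rintro ⟨u, hu0, hu⟩
    have hy := fun y => (hM u y).symm.trans (congrFun hu y)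
    have hsum : ∑ x, u x = 0 := by
      have := Finset.sum_congr (rfl : (Finset.univ : Finset V) = _) fun y _ => hy y
      rw [Finset.sum_add_distrib, Finset.sum_sub_distrib, sum_inEdge_mul hp] at this
      simpa using this
    refine hu0 (IsInvariant.eq_zero hG hp (fun y => ?_) hsum)
    have := hy y
    rw [hsum, Pi.zero_apply] at this
    linarith
  have hπ := isInvariantProb_invariantProb hG hp
  have h1 : G.invariantProb p ᵥ* (1 - G.transitionMatrix p + Matrix.of fun _ _ => (1 : ℝ)) = 1 := by
    ext y
    rw [hM, hπ.2.1, hπ.2.2 y, sub_self, zero_add, Pi.one_apply]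
  rw [← h1, Matrix.vecMul_vecMul, Matrix.mul_nonsing_inv _ (isUnit_iff_ne_zero.2 hdet),
    Matrix.vecMul_one]

lemma measurable_vecMul_inv [DecidableEq V] (x : V) :
    Measurable fun p : G.Edge → ℝ => Matrix.vecMul (1 : V → ℝ)
      (1 - G.transitionMatrix p + Matrix.of fun _ _ => (1 : ℝ))⁻¹ x := by
  have hc : Continuous fun p : G.Edge → ℝ =>
      1 - G.transitionMatrix p + Matrix.of fun _ _ => (1 : ℝ) := by
    classical
    have hP : Continuous fun p : G.Edge → ℝ => G.transitionMatrix p := by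
      refine continuous_matrix fun x y => ?_
      simp only [transitionMatrix, Matrix.of_apply]
      refine continuous_finsetSum _ fun e _ => ?_
      split_ifs <;> fun_prop
    fun_prop
  simp only [Matrix.vecMul, dotProduct, Matrix.inv_def, Ring.inverse_eq_inv', Matrix.smul_apply,
    Pi.one_apply, one_mul, smul_eq_mul]
  refine Finset.measurable_fun_sum _ fun y _ => ?_
  exact (hc.matrix_det.measurable.inv).mul
    (hc.matrix_adjugate.matrix_elem y x).measurable

lemma aemeasurable_reversedEnvironment [Nonempty V] (hG : G.StronglyConnected)
    {μ : Measure (G.Edge → ℝ)} (hμ : ∀ᵐ p ∂μ, p ∈ G.environments) :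
    AEMeasurable G.reversedEnvironment μ := by
  classical
  refine ⟨fun p e => Matrix.vecMul (1 : V → ℝ)
      (1 - G.transitionMatrix p + Matrix.of fun _ _ => (1 : ℝ))⁻¹ (G.unreverse e).1.1 /
    Matrix.vecMul (1 : V → ℝ)
      (1 - G.transitionMatrix p + Matrix.of fun _ _ => (1 : ℝ))⁻¹ (G.unreverse e).1.2 *
    p (G.unreverse e), measurable_pi_lambda _ fun e => ?_, ?_⟩
  · exact ((measurable_vecMul_inv _).div (measurable_vecMul_inv _)).mul (measurable_pi_apply _)
  · filter_upwards [hμ] with p hp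
    ext e
    rw [reversedEnvironment, invariantProb_eq_vecMul_inv hG hp]

end Digraph

namespace Digraph

variable {V : Type*} {G : Digraph V} [Fintype V] {p q : G.Edge → ℝ}

/-! ### Flow monomials separate environments -/

lemma divergence_eq (n : G.Edge → ℝ) (x : V) :
    G.divergence n x = ∑ e : G.OutEdge x, n e.1 - ∑ e : G.InEdge x, n e.1 := by
  unfold divergence outWeight reversedWeight
  rw [sum_outEdge_reversal]

/-- The mean frequencies `π x * p e` with which the stationary chain crosses the edges `e`
form a flow. -/
lemma divergence_invariantProb_mul [Nonempty V] (hG : G.StronglyConnected)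
    (hp : p ∈ G.environments) (x : V) :
    G.divergence (fun e => G.invariantProb p e.1.1 * p e) x = 0 := by
  rw [divergence_eq, (isInvariantProb_invariantProb hG hp).2.2 x, sub_eq_zero,
    ← mul_one (G.invariantProb p x), ← hp.2 x, Finset.mul_sum]
  exact Finset.sum_congr rfl fun e _ => by rw [e.2]

/-- Two environments with the same value of the monomial `∏ e, p e ^ n e`, where `n` is the
stationary flow of the first one, coincide: the logarithms of these values differ by an average
of relative entropies of the transition probabilities out of the vertices. -/
lemma eq_of_prod_rpow_eq [Nonempty V] (hG : G.StronglyConnected)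
    (hp : p ∈ G.environments) (hq : q ∈ G.environments)
    (h : ∏ e, p e ^ (G.invariantProb p e.1.1 * p e) =
      ∏ e, q e ^ (G.invariantProb p e.1.1 * p e)) : p = q := by
  set n : G.Edge → ℝ := fun e => G.invariantProb p e.1.1 * p e with hn
  have hpos : ∀ e, 0 < n e := fun e => mul_pos (invariantProb_pos hG hp _) (hp.1 e)
  have hlog : ∑ e, n e * Real.log (p e) = ∑ e, n e * Real.log (q e) := by
    have := congrArg Real.log h
    rw [Real.log_prod fun e _ => (Real.rpow_pos_of_pos (hp.1 e) _).ne',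
      Real.log_prod fun e _ => (Real.rpow_pos_of_pos (hq.1 e) _).ne'] at this
    simpa only [Real.log_rpow (hp.1 _), Real.log_rpow (hq.1 _)] using this
  have hmass : ∑ e, n e * (q e / p e - 1) = 0 := by
    rw [← sum_outEdge]
    refine Finset.sum_eq_zero fun x _ => ?_
    have : ∀ e : G.OutEdge x, n e.1 * (q e.1 / p e.1 - 1) =
        G.invariantProb p x * (q e.1 - p e.1) := fun e => by
      have := (hp.1 e.1).ne'
      simp only [hn, e.2]
      field_simp
    rw [Finset.sum_congr rfl fun e _ => this e, ← Finset.mul_sum, Finset.sum_sub_distrib,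
      hq.2 x, hp.2 x, sub_self, mul_zero]
  have hterm : ∀ e, 0 < q e / p e := fun e => div_pos (hq.1 e) (hp.1 e)
  have hzero : ∑ e, n e * (q e / p e - 1 - Real.log (q e / p e)) = 0 := by
    simp_rw [mul_sub (n _) (_ - _), Finset.sum_sub_distrib, hmass,
      Real.log_div (hq.1 _).ne' (hp.1 _).ne', mul_sub, Finset.sum_sub_distrib, hlog]
    simp
  have hall := (Finset.sum_eq_zero_iff_of_nonneg fun e _ => mul_nonneg (hpos e).le
    (sub_nonneg.2 (Real.log_le_sub_one_of_pos (hterm e)))).1 hzero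
  ext e
  by_contra hne
  have hlt := Real.log_lt_sub_one_of_pos (hterm e) fun h1 => hne ((div_eq_one_iff_eq
    (hp.1 e).ne').1 h1).symm
  exact (mul_pos (hpos e) (sub_pos.2 hlt)).ne' (hall e (Finset.mem_univ e))

/-! ### Flow moments determine the law of an environment -/

lemma measurableSet_environments : MeasurableSet G.environments := by
  have h : MeasurableSet {p : G.Edge → ℝ | ∀ x, ∑ e : G.OutEdge x, p e.1 = 1} := by
    simp only [Set.ofPred_forall]
    exact MeasurableSet.iInter fun x => measurableSet_eq_fun (by fun_prop) measurable_const
  exact measurableSet_forall_pos.inter h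

lemma le_one_of_mem_environments (hp : p ∈ G.environments) (e : G.Edge) : p e ≤ 1 := by
  rw [← hp.2 e.1.1]
  exact Finset.single_le_sum (f := fun e' : G.OutEdge e.1.1 => p e'.1)
    (fun e' _ => (hp.1 e'.1).le) (Finset.mem_univ ⟨e, rfl⟩)

/-- The environments form a closed subset of the open positive orthant. -/
instance polishSpace_environments : PolishSpace G.environments := by
  have hU : IsOpen {p : G.Edge → ℝ | ∀ e, 0 < p e} := by
    simp only [Set.ofPred_forall]
    exact isOpen_iInter_of_finite fun e => isOpen_lt continuous_const (continuous_apply e)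
  have := hU.polishSpace
  have hsub : G.environments ⊆ {p : G.Edge → ℝ | ∀ e, 0 < p e} := fun p hp => hp.1
  refine Topology.IsClosedEmbedding.polishSpace (f := Set.inclusion hsub)
    ⟨Topology.IsEmbedding.inclusion hsub, ?_⟩
  rw [Set.range_inclusion]
  have : IsClosed {p : {p : G.Edge → ℝ | ∀ e, 0 < p e} |
      ∀ x, ∑ e : G.OutEdge x, p.1 e.1 = 1} := by
    simp only [Set.ofPred_forall]
    exact isClosed_iInter fun x => isClosed_eq (continuous_finsetSum _ fun e _ =>
      (continuous_apply e.1).comp continuous_subtype_val) continuous_const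
  convert this using 1
  ext p
  exact ⟨fun h => h.2, fun h => ⟨p.2, h⟩⟩

lemma continuous_prod_rpow (n : G.Edge → ℝ) :
    Continuous fun p : G.environments => ∏ e, p.1 e ^ n e :=
  continuous_finsetProd _ fun e _ => Continuous.rpow_const
    ((continuous_apply e).comp continuous_subtype_val) fun p => Or.inl (p.2.1 e).ne'

lemma prod_rpow_mem_Icc {n : G.Edge → ℝ} (hn : ∀ e, 0 ≤ n e) (hp : p ∈ G.environments) :
    ∏ e, p e ^ n e ∈ Set.Icc (0 : ℝ) 1 :=
  ⟨Finset.prod_nonneg fun e _ => (Real.rpow_pos_of_pos (hp.1 e) _).le,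
    Finset.prod_le_one (fun e _ => (Real.rpow_pos_of_pos (hp.1 e) _).le) fun e _ =>
      Real.rpow_le_one (hp.1 e).le (le_one_of_mem_environments hp e) (hn e)⟩

open BoundedContinuousFunction

/-- The functions `p ↦ ∏ e, p e ^ n e` on environments, where `n` is a nonnegative real-valued
flow, that is, has zero divergence. -/
def flowMonomials (G : Digraph V) : Submonoid (G.environments →ᵇ ℝ) where
  carrier := {f | ∃ n : G.Edge → ℝ, (∀ e, 0 ≤ n e) ∧ (∀ x, G.divergence n x = 0) ∧
    ∀ p, f p = ∏ e, p.1 e ^ n e}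
  one_mem' := ⟨0, fun _ => le_rfl, fun x => by simp [divergence_eq], fun p => by simp⟩
  mul_mem' := by
    rintro f g ⟨n, hn, hdn, hf⟩ ⟨m, hm, hdm, hg⟩
    refine ⟨n + m, fun e => add_nonneg (hn e) (hm e), fun x => ?_, fun p => ?_⟩
    · have h1 := hdn x
      have h2 := hdm x
      rw [divergence_eq] at h1 h2 ⊢
      simp only [Pi.add_apply, Finset.sum_add_distrib]
      linarith
    · rw [BoundedContinuousFunction.mul_apply, hf, hg, ← Finset.prod_mul_distrib]
      exact Finset.prod_congr rfl fun e _ => (Real.rpow_add (p.2.1 e) _ _).symm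

/-- The star subalgebra spanned by the flow monomials. -/
noncomputable def flowAlgebra (G : Digraph V) : StarSubalgebra ℝ (G.environments →ᵇ ℝ) where
  toSubalgebra := Algebra.adjoin ℝ (G.flowMonomials : Set (G.environments →ᵇ ℝ))
  star_mem' := fun {f} hf => by
    have : star f = f := by ext; simp
    rwa [this]

lemma separatesPoints_flowAlgebra [Nonempty V] (hG : G.StronglyConnected) :
    (G.flowAlgebra.map (toContinuousMapStarₐ ℝ)).SeparatesPoints := by
  intro p q hpq
  set n : G.Edge → ℝ := fun e => G.invariantProb p.1 e.1.1 * p.1 e with hn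
  have hn0 : ∀ e, 0 ≤ n e := fun e => (mul_pos (invariantProb_pos hG p.2 _) (p.2.1 e)).le
  let f : G.environments →ᵇ ℝ := ofNormedAddCommGroup
    (fun p : G.environments => ∏ e, p.1 e ^ n e) (continuous_prod_rpow n) 1 fun p => by
      have := prod_rpow_mem_Icc hn0 p.2
      rw [Real.norm_of_nonneg this.1]
      exact this.2
  have hf : f ∈ G.flowAlgebra := Algebra.subset_adjoin
    ⟨n, hn0, divergence_invariantProb_mul hG p.2, fun _ => rfl⟩
  refine ⟨f, ⟨toContinuousMapStarₐ ℝ f, ⟨f, hf, rfl⟩, rfl⟩, fun h => hpq (Subtype.ext ?_)⟩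
  exact eq_of_prod_rpow_eq hG p.2 q.2 h

/-- A finite measure concentrated on environments is determined by the integrals of the flow
monomials. -/
lemma measure_ext_of_integral_prod_rpow [Nonempty V] (hG : G.StronglyConnected)
    {μ ν : Measure (G.Edge → ℝ)} [IsFiniteMeasure μ] [IsFiniteMeasure ν]
    (hμ : ∀ᵐ p ∂μ, p ∈ G.environments) (hν : ∀ᵐ p ∂ν, p ∈ G.environments)
    (h : ∀ n : G.Edge → ℝ, (∀ e, 0 ≤ n e) → (∀ x, G.divergence n x = 0) →
      ∫ p, ∏ e, p e ^ n e ∂μ = ∫ p, ∏ e, p e ^ n e ∂ν) : μ = ν := by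
  have hemb := MeasurableEmbedding.subtype_coe (measurableSet_environments (G := G))
  have hmap : ∀ {ρ : Measure (G.Edge → ℝ)}, (∀ᵐ p ∂ρ, p ∈ G.environments) →
      (ρ.comap ((↑) : G.environments → _)).map (↑) = ρ := fun {ρ} hρ => by
    rw [hemb.map_comap, Subtype.range_coe, Measure.restrict_eq_self_of_ae_mem hρ]
  rw [← hmap hμ, ← hmap hν]
  congr 1
  refine ext_of_forall_mem_subalgebra_integral_eq_of_polish (separatesPoints_flowAlgebra hG)
    fun g hg => ?_
  have hspan : g ∈ Submodule.span ℝ (G.flowMonomials : Set (G.environments →ᵇ ℝ)) := by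
    rw [← Submonoid.closure_eq G.flowMonomials, ← Algebra.adjoin_eq_span]
    exact hg
  clear hg
  induction hspan using Submodule.span_induction with
  | mem f hf =>
    obtain ⟨n, hn, hdiv, hf⟩ := hf
    simp_rw [hf]
    rw [← hemb.integral_map fun p => ∏ e, p e ^ n e, ← hemb.integral_map fun p => ∏ e, p e ^ n e,
      hmap hμ, hmap hν, h n hn hdiv]
  | zero => simp
  | add f g _ _ hf hg =>
    simp only [BoundedContinuousFunction.add_apply]
    rw [integral_add (f.integrable _) (g.integrable _),
      integral_add (f.integrable _) (g.integrable _), hf, hg]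
  | smul c f _ hf =>
    simp only [BoundedContinuousFunction.smul_apply, integral_smul, hf]

end Digraph

namespace Digraph

variable {V : Type*} {G : Digraph V}

/-! ### Dirichlet environments and their moments -/

lemma measurable_glueOutEdges :
    Measurable fun (q : ∀ x, G.OutEdge x → ℝ) (e : G.Edge) => q e.1.1 ⟨e, rfl⟩ :=
  measurable_pi_lambda _ fun e => (measurable_pi_apply _).comp (measurable_pi_apply e.1.1)

variable [Fintype V] {α n : G.Edge → ℝ}

lemma isProbabilityMeasure_dirichletLaw (r : ∀ x, G.OutEdge x) (hα : ∀ e, 0 < α e) :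
    IsProbabilityMeasure (G.dirichletLaw r α) := by
  have := fun x => isProbabilityMeasure_dirichletMeasure (r x)
    (a := fun e : G.OutEdge x => α e.1) fun e => hα e.1
  exact Measure.isProbabilityMeasure_map measurable_glueOutEdges.aemeasurable

lemma ae_dirichletLaw_mem_environments (r : ∀ x, G.OutEdge x) (hα : ∀ e, 0 < α e) :
    ∀ᵐ p ∂(G.dirichletLaw r α), p ∈ G.environments := by
  have := fun x => isProbabilityMeasure_dirichletMeasure (r x)
    (a := fun e : G.OutEdge x => α e.1) fun e => hα e.1
  rw [dirichletLaw, ae_map_iff (p := (· ∈ G.environments))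
    measurable_glueOutEdges.aemeasurable measurableSet_environments]
  have h : ∀ᵐ q ∂(Measure.pi fun x => dirichletMeasure (r x) fun e : G.OutEdge x => α e.1),
      ∀ x, (∀ e, 0 < q x e) ∧ ∑ e, q x e = 1 :=
    ae_all_iff.2 fun x =>
      (Measure.quasiMeasurePreserving_eval (fun x => dirichletMeasure (r x) fun e => α e.1) x).ae
        (ae_dirichletMeasure (r x) _)
  filter_upwards [h] with q hq
  refine ⟨fun e => (hq e.1.1).1 _, fun x => ?_⟩
  rw [← (hq x).2]
  refine Finset.sum_congr rfl fun e _ => ?_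
  obtain ⟨e, rfl⟩ := e
  rfl

lemma integral_prod_rpow_dirichletLaw (r : ∀ x, G.OutEdge x) (hα : ∀ e, 0 < α e)
    (hn : ∀ e, 0 ≤ n e) :
    ∫ p, ∏ e, p e ^ n e ∂(G.dirichletLaw r α) =
      (∏ x, Real.Gamma (G.outWeight α x) / Real.Gamma (G.outWeight (fun e => α e + n e) x)) *
        ∏ e, (Real.Gamma (α e + n e) / Real.Gamma (α e)) := by
  have := fun x => isProbabilityMeasure_dirichletMeasure (r x)
    (a := fun e : G.OutEdge x => α e.1) fun e => hα e.1
  have hm : Measurable fun p : G.Edge → ℝ => ∏ e, p e ^ n e := by fun_prop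
  rw [dirichletLaw, integral_map measurable_glueOutEdges.aemeasurable hm.aestronglyMeasurable]
  have h : ∀ q : ∀ x, G.OutEdge x → ℝ, ∏ e : G.Edge, q e.1.1 ⟨e, rfl⟩ ^ n e =
      ∏ x, ∏ e, q x e ^ n e.1 := fun q => by
    rw [← prod_outEdge]
    refine Finset.prod_congr rfl fun x _ => Finset.prod_congr rfl fun e _ => ?_
    obtain ⟨e, rfl⟩ := e
    rfl
  simp_rw [h]
  rw [integral_fintype_prod_eq_prod fun x (q : G.OutEdge x → ℝ) => ∏ e, q e ^ n e.1,
    ← prod_outEdge fun e => Real.Gamma (α e + n e) / Real.Gamma (α e), ← Finset.prod_mul_distrib]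
  exact Finset.prod_congr rfl fun x _ =>
    integral_prod_rpow_dirichletMeasure (r x) (fun e => hα e.1) fun e => hn e.1

lemma outWeight_reversedWeight (hdiv : ∀ x, G.divergence α x = 0) (x : V) :
    G.reversal.outWeight (G.reversedWeight α) x = G.outWeight α x :=
  (sub_eq_zero.1 (hdiv x)).symm

/-- The flow moments of a Dirichlet environment with divergence-free weights are unchanged when
both the graph and the flow are reversed, since all vertex sums are. -/
lemma integral_prod_rpow_reversal (r : ∀ x, G.OutEdge x) (r' : ∀ x, G.reversal.OutEdge x)
    (hα : ∀ e, 0 < α e) (hn : ∀ e, 0 ≤ n e) (hdiv : ∀ x, G.divergence α x = 0)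
    (hdivn : ∀ x, G.divergence n x = 0) :
    ∫ p, ∏ e, p e ^ G.reversedWeight n e ∂(G.reversal.dirichletLaw r' (G.reversedWeight α)) =
      ∫ p, ∏ e, p e ^ n e ∂(G.dirichletLaw r α) := by
  have hdiv' : ∀ x, G.divergence (fun e => α e + n e) x = 0 := fun x => by
    have h1 := hdiv x
    have h2 := hdivn x
    rw [divergence_eq] at h1 h2 ⊢
    simp only [Finset.sum_add_distrib]
    linarith
  rw [integral_prod_rpow_dirichletLaw r hα hn,
    integral_prod_rpow_dirichletLaw r' (α := G.reversedWeight α) (n := G.reversedWeight n)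
      (fun e => hα _) (fun e => hn _)]
  congr 1
  · refine Finset.prod_congr rfl fun x _ => ?_
    rw [outWeight_reversedWeight hdiv, ← outWeight_reversedWeight hdiv']
    rfl
  · exact G.unreverseEquiv.prod_comp fun e => Real.Gamma (α e + n e) / Real.Gamma (α e)

/-- The ratios of stationary weights in the reversed environment cancel out in the monomial of
a flow. -/
lemma prod_reversedEnvironment_rpow [Nonempty V] (hG : G.StronglyConnected) {p : G.Edge → ℝ}
    (hp : p ∈ G.environments) (hdiv : ∀ x, G.divergence n x = 0) :
    ∏ e, G.reversedEnvironment p e ^ G.reversedWeight n e = ∏ e, p e ^ n e := by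
  have hπ := invariantProb_pos hG hp
  refine (G.unreverseEquiv.prod_comp fun e =>
    (G.invariantProb p e.1.1 / G.invariantProb p e.1.2 * p e) ^ n e).trans ?_
  have h : ∀ e : G.Edge, (G.invariantProb p e.1.1 / G.invariantProb p e.1.2 * p e) ^ n e =
      G.invariantProb p e.1.1 ^ n e / G.invariantProb p e.1.2 ^ n e * p e ^ n e := fun e => by
    rw [Real.mul_rpow (div_pos (hπ _) (hπ _)).le (hp.1 e).le, Real.div_rpow (hπ _).le (hπ _).le]
  simp_rw [h, Finset.prod_mul_distrib, Finset.prod_div_distrib]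
  rw [← prod_outEdge fun e => G.invariantProb p e.1.1 ^ n e,
    ← prod_inEdge fun e => G.invariantProb p e.1.2 ^ n e]
  have hv : ∀ x, ∏ e : G.OutEdge x, G.invariantProb p e.1.1.1 ^ n e.1 =
      ∏ e : G.InEdge x, G.invariantProb p e.1.1.2 ^ n e.1 := fun x => by
    have hx := hdiv x
    rw [divergence_eq, sub_eq_zero] at hx
    have h1 : ∀ e : G.OutEdge x, G.invariantProb p e.1.1.1 ^ n e.1 =
        G.invariantProb p x ^ n e.1 := fun e => by rw [e.2]
    have h2 : ∀ e : G.InEdge x, G.invariantProb p e.1.1.2 ^ n e.1 =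
        G.invariantProb p x ^ n e.1 := fun e => by rw [e.2]
    simp_rw [h1, h2, ← Real.rpow_sum_of_pos (hπ x), hx]
  simp_rw [hv]
  rw [div_self, one_mul]
  exact Finset.prod_ne_zero_iff.2 fun x _ => Finset.prod_ne_zero_iff.2 fun e _ =>
    (Real.rpow_pos_of_pos (hπ _) _).ne'

end Digraph

theorem proposition1 {V : Type*} [Fintype V] [Nonempty V] (G : Digraph V)
    (hG : G.StronglyConnected) (α : G.Edge → ℝ) (hα : ∀ e, 0 < α e)
    (hdiv : ∀ x, G.divergence α x = 0)
    (r : ∀ x, G.OutEdge x) (r' : ∀ x, G.reversal.OutEdge x) :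
    (∀ p ∈ G.environments, ∃! π : V → ℝ, G.IsInvariantProb p π) ∧
    IsProbabilityMeasure (G.dirichletLaw r α) ∧
    (∀ᵐ p ∂(G.dirichletLaw r α), p ∈ G.environments) ∧
    HasLaw G.reversedEnvironment (G.reversal.dirichletLaw r' (G.reversedWeight α))
      (G.dirichletLaw r α) := by
  have hα' : ∀ e, 0 < G.reversedWeight α e := fun e => hα _
  have hprob := Digraph.isProbabilityMeasure_dirichletLaw r hα
  have hprob' := Digraph.isProbabilityMeasure_dirichletLaw r' hα'
  have henv := Digraph.ae_dirichletLaw_mem_environments r hα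
  have hmeas := Digraph.aemeasurable_reversedEnvironment hG henv
  refine ⟨fun p hp => Digraph.existsUnique_isInvariantProb hG hp, hprob, henv, hmeas, ?_⟩
  have henv_map : ∀ᵐ p ∂((G.dirichletLaw r α).map G.reversedEnvironment),
      p ∈ G.reversal.environments := by
    rw [ae_map_iff (p := (· ∈ G.reversal.environments)) hmeas
      Digraph.measurableSet_environments]
    filter_upwards [henv] with p hp using Digraph.reversedEnvironment_mem_environments hG hp
  refine Digraph.measure_ext_of_integral_prod_rpow hG.reversal henv_map
    (Digraph.ae_dirichletLaw_mem_environments r' hα') fun m hm hdivm => ?_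
  -- Reversal is an involution on graphs, so that `m` is the reversal of a flow `n` on `G`.
  obtain ⟨n, rfl⟩ : ∃ n : G.Edge → ℝ, G.reversedWeight n = m :=
    ⟨G.reversal.reversedWeight m, rfl⟩
  have hn : ∀ e, 0 ≤ n e := fun e => hm (G.unreverseEquiv.symm e)
  have hdivn : ∀ x, G.divergence n x = 0 := fun x => by
    have h := hdivm x
    unfold Digraph.divergence at h ⊢
    rw [← neg_eq_zero, neg_sub]
    exact h
  have hmm : Measurable fun p : G.reversal.Edge → ℝ => ∏ e, p e ^ G.reversedWeight n e := by
    fun_prop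
  rw [integral_map hmeas hmm.aestronglyMeasurable,
    Digraph.integral_prod_rpow_reversal r r' hα hn hdiv hdivn]
  refine integral_congr_ae ?_
  filter_upwards [henv] with p hp using Digraph.prod_reversedEnvironment_rpow hG hp hdivn
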